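/- For a complex $m\times n$ matrix $X$ let $\|X\|_S$ denote its Schur norm, i.e. the norm of the linear map $A\mapsto X\circ A$ (entrywise product) on the space of complex $m\times n$ matrices equipped with the operator norm. A Schur factorization of $X$ is a factorization $X=\|X\|_S\,FWG$ in which $F$ is a positive semidefinite $m\times m$ matrix with $\mathrm{diag}(F^2)\le I_m$, $G$ is a positive semidefinite $n\times n$ matrix with $\mathrm{diag}(G^2)\le I_n$, and $W$ is an $m\times n$ partial isometry from the range of $G$ onto the range of $F$ (that is, with initial space the range of $G$ and final space the range of $F$). Let $X$ be a complex $m\times n$ matrix. If for every column of $X$ the matrix obtained by deleting that column has Schur norm strictly smaller than $\|X\|_S$, then $X$ has exactly one Schur factorization, i.e. there is exactly one such triple $(F,W,G)$. Likewise, if for every row of $X$ the matrix obtained by deleting that row has Schur norm strictly smaller than $\|X\|_S$, then $X$ has exactly one Schur factorization. -/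

import Mathlib

open scoped Matrix Matrix.Norms.L2Operator ComplexOrder

noncomputable section

/-- The Schur multiplier `S_X : A ↦ X ⊙ A` (entrywise product), a linear operator on the space of
`m × n` complex matrices normed by the operator norm between Euclidean spaces. -/
def schurMultiplier {m n : Type*} [Fintype m] [Fintype n] [DecidableEq n]
    (X : Matrix m n ℂ) : Matrix m n ℂ →L[ℂ] Matrix m n ℂ :=
  LinearMap.toContinuousLinearMap
    { toFun := fun A => X ⊙ A
      map_add' := fun A B => Matrix.hadamard_add X A B
      map_smul' := fun c A => Matrix.hadamard_smul X A c }

/-- The Schur norm `‖X‖_S`: the operator norm of the Schur multiplier `S_X`. -/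
def schurNorm {m n : Type*} [Fintype m] [Fintype n] [DecidableEq n] (X : Matrix m n ℂ) : ℝ :=
  ‖schurMultiplier X‖

/-- `W` is a partial isometry from the range of `G` onto the range of `F`:
`W` is a partial isometry (`W W* W = W`), its initial space `(ker W)ᗮ = range W*` is the range
of `G`, and its final space `range W` is the range of `F`. -/
structure IsPartialIsometryBetween {m n : Type*} [Fintype m] [Fintype n]
    (F : Matrix m m ℂ) (W : Matrix m n ℂ) (G : Matrix n n ℂ) : Prop where
  partialIsometry : W * Wᴴ * W = W
  initial : LinearMap.range Wᴴ.mulVecLin = LinearMap.range G.mulVecLin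
  final : LinearMap.range W.mulVecLin = LinearMap.range F.mulVecLin

/-- `X = ‖X‖_S F W G` is a Schur factorization of `X`. -/
structure IsSchurFactorization {m n : Type*} [Fintype m] [Fintype n] [DecidableEq m]
    [DecidableEq n] (X : Matrix m n ℂ)
    (F : Matrix m m ℂ) (W : Matrix m n ℂ) (G : Matrix n n ℂ) : Prop where
  eq_smul : X = (schurNorm X : ℂ) • (F * W * G)
  left_pos : F.PosSemidef
  left_diag : ∀ i, (F ^ 2) i i ≤ 1
  right_pos : G.PosSemidef
  right_diag : ∀ j, (G ^ 2) j j ≤ 1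
  isometry : IsPartialIsometryBetween F W G

/-- `X` with its `j`-th column deleted. -/
def deleteCol {m n : Type*} (X : Matrix m n ℂ) (j : n) : Matrix m {k : n // k ≠ j} ℂ :=
  X.submatrix id Subtype.val

/-- `X` with its `i`-th row deleted. -/
def deleteRow {m n : Type*} (X : Matrix m n ℂ) (i : m) : Matrix {k : m // k ≠ i} n ℂ :=
  X.submatrix Subtype.val id

end

/-! By Haagerup's theorem, `‖X‖_S ≤ r` with `r > 0` holds exactly when `X = Aᴴ * B` with the
diagonals of `Aᴴ * A` and `Bᴴ * B` at most `r`; equivalently, `X` is the corner of a positive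
semidefinite matrix with diagonal at most `r` (`IsGramDominated`). Sufficiency is the Schur product
theorem. For necessity, a polar decomposition bounds each weighted average of the diagonal,
Hahn–Banach separation turns this into a pointwise bound up to `ε`, and compactness removes `ε`.

Existence: compressing `A` and `B` to a common range and taking polar decompositions gives `F * W *
G` (`exists_reduced_factorization`).

Uniqueness, with `‖X‖_S = 1`: if deleting column `j` lowers the norm, then `(Bᴴ * B) j j = 1` in
every feasible factorization. Otherwise, mixing in a little of a factorization that is cheap except
at `j` would push the whole diagonal below 1 (`one_le_of_isGramDominated`). Hence projecting `B`
onto the range of `A` loses nothing, and `B = A * Z`. Applied to the average of two Schur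
factorizations, this yields one `Z` with `Wᵢ * Gᵢ = Fᵢ * Z`, so `Gᵢ² = (Wᵢ * Gᵢ)ᴴ * (Wᵢ * Gᵢ) = Zᴴ *
X` does not depend on `i`. Then `X` and `G` determine `F`, and finally `W`. Rows follow by taking
adjoints. -/

namespace Matrix

/-! ### Pseudoinverses, square roots and polar decomposition. -/

section Polar

variable {k m n : Type*} [Fintype k] [Fintype m] [Fintype n]

/-- The Moore–Penrose inverse of a Hermitian matrix. -/
theorem IsHermitian.exists_pinv {H : Matrix n n ℂ} (hH : H.IsHermitian) :
    ∃ K : Matrix n n ℂ, K.IsHermitian ∧ H * K * H = H ∧ K * H * K = K ∧ K * H = H * K := by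
  classical
  have hc : ∀ f : ℝ → ℝ, ContinuousOn f (spectrum ℝ H) := fun f =>
    (finite_real_spectrum (A := H)).continuousOn f
  have hH' : IsSelfAdjoint H := hH
  have hid : cfc (fun x : ℝ => x) H = H := cfc_id' ℝ H
  have e1 : cfc (fun x : ℝ => x⁻¹) H * H = cfc (fun x : ℝ => x⁻¹ * x) H := by
    conv_lhs => rw [← hid]
    rw [hid, cfc_mul (fun x : ℝ => x⁻¹) (fun x => x) H (hc _) (hc _), hid]
  have e2 : H * cfc (fun x : ℝ => x⁻¹) H = cfc (fun x : ℝ => x * x⁻¹) H := by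
    rw [cfc_mul (fun x : ℝ => x) (fun x => x⁻¹) H (hc _) (hc _), hid]
  -- The convention `0⁻¹ = 0` makes this the inverse on the range of `H` and zero on its kernel.
  refine ⟨cfc (fun x : ℝ => x⁻¹) H, cfc_predicate (R := ℝ) _ H, ?_, ?_, ?_⟩
  · rw [e2]
    conv_lhs => arg 2; rw [← hid]
    rw [← cfc_mul (fun x : ℝ => x * x⁻¹) (fun x => x) H (hc _) (hc _)]
    simpa [mul_inv_mul_cancel] using hid
  · rw [e1, ← cfc_mul (fun x : ℝ => x⁻¹ * x) (fun x => x⁻¹) H (hc _) (hc _)]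
    congr 1
    funext x
    rcases eq_or_ne x 0 with rfl | hx
    · simp
    · field_simp
  · rw [e1, e2]
    simp only [mul_comm]

section Sqrt

open scoped MatrixOrder

theorem PosSemidef.exists_sqrt {A : Matrix n n ℂ} (hA : A.PosSemidef) :
    ∃ H : Matrix n n ℂ, H.PosSemidef ∧ H * H = A := by
  classical
  exact ⟨CFC.sqrt A, nonneg_iff_posSemidef.1 (CFC.sqrt_nonneg A), CFC.sqrt_mul_sqrt_self A hA.nonneg⟩

theorem PosSemidef.eq_of_mul_self_eq {A B : Matrix n n ℂ} (hA : A.PosSemidef)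
    (hB : B.PosSemidef) (h : A * A = B * B) : A = B := by
  classical
  exact (CFC.mul_self_eq_mul_self_iff A B hA.nonneg hB.nonneg).1 h

theorem PosSemidef.exists_gram {A : Matrix n n ℂ} (hA : A.PosSemidef) :
    ∃ C : Matrix n n ℂ, Cᴴ * C = A := by
  obtain ⟨H, hH, h⟩ := hA.exists_sqrt
  exact ⟨H, by rw [hH.isHermitian.eq, h]⟩

end Sqrt

/-- Polar decomposition of a rectangular matrix, with the range information expressed by
factorizations. -/
theorem exists_polar (T : Matrix k n ℂ) :
    ∃ (U : Matrix k n ℂ) (H : Matrix n n ℂ) (K : Matrix n n ℂ), H.PosSemidef ∧ H * H = Tᴴ * T ∧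
      T = U * H ∧ U = T * K ∧ U * Uᴴ * U = U ∧ H = Uᴴ * U * H ∧ Uᴴ = H * (K * Uᴴ) := by
  obtain ⟨H, hH, hHT⟩ := (posSemidef_conjTranspose_mul_self T).exists_sqrt
  obtain ⟨K, hK, h1, h2, h3⟩ := hH.isHermitian.exists_pinv
  have hUU : (T * K)ᴴ * (T * K) = K * H := by
    calc (T * K)ᴴ * (T * K) = K * (Tᴴ * T) * K := by
          rw [conjTranspose_mul, hK.eq]; simp only [Matrix.mul_assoc]
      _ = K * H * (H * K) := by rw [← hHT]; simp only [Matrix.mul_assoc]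
      _ = K * H * K * H := by rw [← h3]; simp only [Matrix.mul_assoc]
      _ = K * H := by rw [h2]
  -- `1 - K * H` projects onto the kernel of `H`, which `T` annihilates because `Tᴴ * T = H * H`.
  have hT : T * (K * H) = T := by
    classical
    have : (T * (1 - K * H))ᴴ * (T * (1 - K * H)) = 0 := by
      have e : H * (1 - K * H) = 0 := by
        rw [Matrix.mul_sub, Matrix.mul_one, ← Matrix.mul_assoc, h1, sub_self]
      calc (T * (1 - K * H))ᴴ * (T * (1 - K * H))
          = (1 - K * H)ᴴ * (Tᴴ * T) * (1 - K * H) := by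
            rw [conjTranspose_mul]; simp only [Matrix.mul_assoc]
        _ = (1 - K * H)ᴴ * (H * (H * (1 - K * H))) := by
            rw [← hHT]; simp only [Matrix.mul_assoc]
        _ = 0 := by rw [e]; simp
    rw [conjTranspose_mul_self_eq_zero, Matrix.mul_sub, Matrix.mul_one, sub_eq_zero] at this
    exact this.symm
  have hUUU : T * K * (T * K)ᴴ * (T * K) = T * K := by
    rw [Matrix.mul_assoc, hUU, Matrix.mul_assoc, h3, ← Matrix.mul_assoc K, h2]
  refine ⟨T * K, H, K, hH, hHT, ?_, rfl, hUUU, ?_, ?_⟩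
  · rw [Matrix.mul_assoc, hT]
  · rw [hUU, h3, h1]
  · calc (T * K)ᴴ = (T * K * ((T * K)ᴴ * (T * K)))ᴴ := by rw [← Matrix.mul_assoc, hUUU]
      _ = (T * K)ᴴ * (T * K) * (T * K)ᴴ := by
        rw [conjTranspose_mul (T * K), conjTranspose_mul, conjTranspose_conjTranspose]
      _ = H * (K * (T * K)ᴴ) := by rw [hUU, h3, Matrix.mul_assoc]

end Polar

section Range

variable {k m n p : Type*} [Fintype m] [Fintype n]

theorem exists_eq_mul_of_range_le {A : Matrix k m ℂ} {B : Matrix k n ℂ}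
    (h : LinearMap.range A.mulVecLin ≤ LinearMap.range B.mulVecLin) :
    ∃ C : Matrix n m ℂ, A = B * C := by
  classical
  have (j : m) : ∃ c : n → ℂ, B *ᵥ c = A.col j := by
    obtain ⟨c, hc⟩ := h ⟨Pi.single j 1, rfl⟩
    exact ⟨c, by simpa using hc⟩
  choose c hc using this
  refine ⟨of fun i j => c j i, ?_⟩
  ext i j
  have := congrFun (hc j) i
  simpa [mulVec, dotProduct, mul_apply] using this.symm

theorem range_mulVecLin_eq {A : Matrix k m ℂ} {B : Matrix k n ℂ} {C : Matrix n m ℂ}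
    {D : Matrix m n ℂ} (h : A = B * C) (h' : B = A * D) :
    LinearMap.range A.mulVecLin = LinearMap.range B.mulVecLin := by
  apply le_antisymm
  · rw [h, mulVecLin_mul]
    exact LinearMap.range_comp_le_range _ _
  · rw [h', mulVecLin_mul]
    exact LinearMap.range_comp_le_range _ _

end Range

end Matrix

namespace Matrix

/-! ### Operator norm bounds as positivity conditions. -/

section Norm

variable {m n : Type*} [Fintype m] [Fintype n] [DecidableEq n]

open scoped MatrixOrder in
theorem l2_opNorm_le_iff_posSemidef {A : Matrix m n ℂ} {a : ℝ} (ha : 0 ≤ a) :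
    ‖A‖ ≤ a ↔ (((a ^ 2 : ℝ) : ℂ) • (1 : Matrix n n ℂ) - Aᴴ * A).PosSemidef := by
  have h1 : ‖A‖ ≤ a ↔ ‖Aᴴ * A‖ ≤ a ^ 2 := by
    rw [l2_opNorm_conjTranspose_mul_self, ← sq, sq_le_sq₀ (norm_nonneg _) ha]
  have h2 := CStarAlgebra.norm_le_iff_le_algebraMap (Aᴴ * A) (sq_nonneg a)
    (posSemidef_conjTranspose_mul_self A).nonneg
  rw [h1, h2, le_iff, Algebra.algebraMap_eq_smul_one]
  rfl

/-- A Schur complement argument. In this form a norm bound can be multiplied entrywise by a positive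
semidefinite matrix. -/
theorem l2_opNorm_le_iff_fromBlocks_posSemidef [DecidableEq m] {A : Matrix m n ℂ} {a : ℝ} (ha : 0 < a) :
    ‖A‖ ≤ a ↔
      (fromBlocks ((a : ℂ) • (1 : Matrix m m ℂ)) A Aᴴ ((a : ℂ) • 1)).PosSemidef := by
  have hpos : ((a : ℂ) • (1 : Matrix m m ℂ)).PosDef := PosDef.one.smul (by exact_mod_cast ha)
  have hac : (a : ℂ) ≠ 0 := by exact_mod_cast ha.ne'
  have hinv : ((a : ℂ) • (1 : Matrix m m ℂ))⁻¹ = (a : ℂ)⁻¹ • 1 := by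
    apply inv_eq_left_inv
    rw [smul_mul_smul_comm, inv_mul_cancel₀ hac, one_smul, Matrix.one_mul]
  let : Invertible ((a : ℂ) • (1 : Matrix m m ℂ)) := hpos.isUnit.invertible
  rw [PosDef.fromBlocks₁₁ A _ hpos, hinv, l2_opNorm_le_iff_posSemidef ha.le]
  have e : ((a ^ 2 : ℝ) : ℂ) • (1 : Matrix n n ℂ) - Aᴴ * A
      = (a : ℂ) • ((a : ℂ) • (1 : Matrix n n ℂ) - Aᴴ * ((a : ℂ)⁻¹ • (1 : Matrix m m ℂ)) * A) := by
    rw [smul_sub, smul_smul, Matrix.mul_smul, Matrix.smul_mul, smul_smul, mul_inv_cancel₀ hac,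
      one_smul, Matrix.mul_one, sq, Complex.ofReal_mul]
  constructor
  · intro h
    rw [e] at h
    have := h.smul (a := (a : ℂ)⁻¹) (inv_nonneg.2 (by exact_mod_cast ha.le))
    rwa [smul_smul, inv_mul_cancel₀ hac, one_smul] at this
  · intro h
    rw [e]
    exact h.smul (by exact_mod_cast ha.le)


theorem norm_dotProduct_mulVec_le (A : Matrix m n ℂ) (x : m → ℂ) (y : n → ℂ) :
    ‖x ⬝ᵥ A *ᵥ y‖ ≤ ‖A‖ * (√(∑ i, ‖x i‖ ^ 2) * √(∑ j, ‖y j‖ ^ 2)) := by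
  have h1 : x ⬝ᵥ A *ᵥ y = inner ℂ (WithLp.toLp 2 (star x)) (WithLp.toLp 2 (A *ᵥ y)) := by
    rw [EuclideanSpace.inner_eq_star_dotProduct, dotProduct_comm]
    simp
  rw [h1]
  refine (norm_inner_le_norm _ _).trans ?_
  have h2 := l2_opNorm_mulVec A (WithLp.toLp 2 y)
  have h3 : ‖(WithLp.toLp 2 (star x) : EuclideanSpace ℂ m)‖ = √(∑ i, ‖x i‖ ^ 2) := by
    simp [EuclideanSpace.norm_eq]
  have h4 : ‖(WithLp.toLp 2 y : EuclideanSpace ℂ n)‖ = √(∑ i, ‖y i‖ ^ 2) := by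
    simp [EuclideanSpace.norm_eq]
  rw [h4] at h2
  rw [h3]
  calc _ ≤ √(∑ i, ‖x i‖ ^ 2) * (‖A‖ * √(∑ i, ‖y i‖ ^ 2)) :=
        mul_le_mul_of_nonneg_left h2 (Real.sqrt_nonneg _)
    _ = _ := by ring

theorem l2_opNorm_le_one_of_partialIsometry {U : Matrix m n ℂ} (hU : U * Uᴴ * U = U) :
    ‖U‖ ≤ 1 := by
  have h : (Uᴴ * U)ᴴ * (Uᴴ * U) = Uᴴ * U := by
    rw [conjTranspose_mul, conjTranspose_conjTranspose, Matrix.mul_assoc, ← Matrix.mul_assoc U,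
      hU]
  have h2 : ‖Uᴴ * U‖ * ‖Uᴴ * U‖ = ‖Uᴴ * U‖ := by
    rw [← l2_opNorm_conjTranspose_mul_self, h]
  rw [l2_opNorm_conjTranspose_mul_self] at h2
  by_contra! h1
  nlinarith [mul_pos (lt_trans one_pos h1) (lt_trans one_pos h1),
    mul_lt_mul h1 h1.le one_pos (norm_nonneg U)]

end Norm

end Matrix

open Matrix

/-! ### Elementary properties of the Schur norm. -/

section SchurNorm

variable {m n : Type*} [Fintype m] [Fintype n] [DecidableEq n]

theorem schurNorm_nonneg (X : Matrix m n ℂ) : 0 ≤ schurNorm X :=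
  ContinuousLinearMap.opNorm_nonneg _

theorem norm_hadamard_le (X A : Matrix m n ℂ) : ‖X ⊙ A‖ ≤ schurNorm X * ‖A‖ :=
  (schurMultiplier X).le_opNorm A

theorem schurNorm_le_bound {X : Matrix m n ℂ} {r : ℝ} (hr : 0 ≤ r)
    (h : ∀ A : Matrix m n ℂ, ‖X ⊙ A‖ ≤ r * ‖A‖) : schurNorm X ≤ r :=
  (schurMultiplier X).opNorm_le_bound hr h

theorem schurNorm_smul_le (c : ℂ) (X : Matrix m n ℂ) :
    schurNorm (c • X) ≤ ‖c‖ * schurNorm X := by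
  refine schurNorm_le_bound (mul_nonneg (norm_nonneg _) (schurNorm_nonneg X)) fun A => ?_
  rw [smul_hadamard, norm_smul, mul_assoc]
  exact mul_le_mul_of_nonneg_left (norm_hadamard_le X A) (norm_nonneg _)

theorem schurNorm_smul (c : ℂ) (X : Matrix m n ℂ) : schurNorm (c • X) = ‖c‖ * schurNorm X := by
  refine le_antisymm (schurNorm_smul_le c X) ?_
  rcases eq_or_ne c 0 with rfl | hc
  · simpa using schurNorm_nonneg (0 : Matrix m n ℂ)
  have h := schurNorm_smul_le c⁻¹ (c • X)
  rw [smul_smul, inv_mul_cancel₀ hc, one_smul, norm_inv] at h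
  exact (le_inv_mul_iff₀ (norm_pos_iff.2 hc)).1 h

theorem eq_zero_of_schurNorm_eq_zero {X : Matrix m n ℂ} (h : schurNorm X = 0) : X = 0 := by
  have := norm_hadamard_le X (of fun _ _ => 1)
  rw [h, zero_mul, norm_le_zero_iff] at this
  ext i j
  simpa using congrFun (congrFun this i) j

theorem schurNorm_conjTranspose [DecidableEq m] (X : Matrix m n ℂ) :
    schurNorm Xᴴ = schurNorm X := by
  refine le_antisymm ?_ ?_
  · refine schurNorm_le_bound (schurNorm_nonneg X) fun A => ?_
    have h := norm_hadamard_le X Aᴴ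
    rw [← l2_opNorm_conjTranspose, l2_opNorm_conjTranspose A] at h
    convert h using 2
    ext i j
    simp
  · refine schurNorm_le_bound (schurNorm_nonneg _) fun A => ?_
    have h := norm_hadamard_le Xᴴ Aᴴ
    rw [← l2_opNorm_conjTranspose, l2_opNorm_conjTranspose A] at h
    convert h using 2
    ext i j
    simp

end SchurNorm

/-! ### Gram factorizations and the easy half of Haagerup's theorem. -/

section Gram

variable {m n : Type*}

/-- `X` is the off-diagonal block of a positive semidefinite matrix whose diagonal is at
most `d`. -/
def IsGramDominated (X : Matrix m n ℂ) (d : m ⊕ n → ℝ) : Prop :=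
  ∃ M : Matrix (m ⊕ n) (m ⊕ n) ℂ, M.PosSemidef ∧ M.toBlocks₁₂ = X ∧ ∀ s, (M s s).re ≤ d s

theorem IsGramDominated.mono {X : Matrix m n ℂ} {d e : m ⊕ n → ℝ} (h : IsGramDominated X d)
    (hde : ∀ s, d s ≤ e s) : IsGramDominated X e := by
  obtain ⟨M, hM, hX, hd⟩ := h
  exact ⟨M, hM, hX, fun s => (hd s).trans (hde s)⟩

theorem IsGramDominated.add {X Y : Matrix m n ℂ} {d e : m ⊕ n → ℝ} (hX : IsGramDominated X d)
    (hY : IsGramDominated Y e) : IsGramDominated (X + Y) (d + e) := by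
  obtain ⟨M, hM, rfl, hd⟩ := hX
  obtain ⟨N, hN, rfl, he⟩ := hY
  exact ⟨M + N, hM.add hN, rfl, fun s => by simpa using add_le_add (hd s) (he s)⟩

theorem IsGramDominated.smul {X : Matrix m n ℂ} {d : m ⊕ n → ℝ} (hX : IsGramDominated X d)
    {t : ℝ} (ht : 0 ≤ t) : IsGramDominated ((t : ℂ) • X) (t • d) := by
  obtain ⟨M, hM, rfl, hd⟩ := hX
  exact ⟨(t : ℂ) • M, hM.smul (by exact_mod_cast ht), rfl,
    fun s => by simpa using mul_le_mul_of_nonneg_left (hd s) ht⟩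

variable [Fintype m] [Fintype n]

theorem isGramDominated_conjTranspose_mul {k : Type*} [Fintype k] (A : Matrix k m ℂ)
    (B : Matrix k n ℂ) :
    IsGramDominated (Aᴴ * B)
      (Sum.elim (fun i => ((Aᴴ * A) i i).re) (fun j => ((Bᴴ * B) j j).re)) := by
  refine ⟨(fromCols A B)ᴴ * fromCols A B, posSemidef_conjTranspose_mul_self _, ?_, ?_⟩
  · ext i j
    simp [toBlocks₁₂, mul_apply]
  · rintro (i | j) <;> simp [mul_apply]

theorem IsGramDominated.exists_factorization {X : Matrix m n ℂ} {d : m ⊕ n → ℝ}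
    (h : IsGramDominated X d) :
    ∃ (A : Matrix (m ⊕ n) m ℂ) (B : Matrix (m ⊕ n) n ℂ), Aᴴ * B = X ∧
      (∀ i, ((Aᴴ * A) i i).re ≤ d (.inl i)) ∧ ∀ j, ((Bᴴ * B) j j).re ≤ d (.inr j) := by
  obtain ⟨M, hM, rfl, hd⟩ := h
  obtain ⟨C, rfl⟩ := hM.exists_gram
  refine ⟨C.toCols₁, C.toCols₂, ?_, fun i => ?_, fun j => ?_⟩
  · ext i j
    simp [toBlocks₁₂, mul_apply, toCols₁, toCols₂]
  · simpa [mul_apply, toCols₁] using hd (.inl i)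
  · simpa [mul_apply, toCols₂] using hd (.inr j)

theorem IsGramDominated.schurNorm_le [DecidableEq n] {X : Matrix m n ℂ} {r : ℝ} (hr : 0 < r)
    (h : IsGramDominated X fun _ => r) : schurNorm X ≤ r := by
  classical
  obtain ⟨M, hM, hX, hd⟩ := h
  refine schurNorm_le_bound hr.le fun A => ?_
  rcases eq_or_ne A 0 with rfl | hA
  · simp
  have ha : 0 < ‖A‖ := norm_pos_iff.2 hA
  have hN := (l2_opNorm_le_iff_fromBlocks_posSemidef (A := A) ha).1 le_rfl
  rw [l2_opNorm_le_iff_fromBlocks_posSemidef (mul_pos hr ha)]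
  -- The Schur product of `M` with the block matrix of `A` has diagonal `‖A‖ * M s s`; this diagonal
  -- slack raises it to `r * ‖A‖`.
  have hD : (diagonal fun s => ((‖A‖ * (r - (M s s).re) : ℝ) : ℂ)).PosSemidef :=
    PosSemidef.diagonal fun s => by
      have : 0 ≤ ‖A‖ * (r - (M s s).re) := mul_nonneg ha.le (sub_nonneg.2 (hd s))
      simpa using (by exact_mod_cast this : (0 : ℂ) ≤ ((‖A‖ * (r - (M s s).re) : ℝ) : ℂ))
  have hdiag (s) : ((M s s).re : ℂ) = M s s := hM.isHermitian.coe_re_apply_self s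
  suffices fromBlocks (((r * ‖A‖ : ℝ) : ℂ) • 1) (X ⊙ A) (X ⊙ A)ᴴ (((r * ‖A‖ : ℝ) : ℂ) • 1) =
      M ⊙ fromBlocks ((‖A‖ : ℂ) • 1) A Aᴴ ((‖A‖ : ℂ) • 1) +
        diagonal fun s => ((‖A‖ * (r - (M s s).re) : ℝ) : ℂ) by
    rw [this]
    exact (hM.hadamard hN).add hD
  subst hX
  ext (i | i) (j | j)
  · rcases eq_or_ne i j with rfl | hij
    · simp [hdiag]; ring
    · simp [hij]
  · simp [toBlocks₁₂]
  · simp [toBlocks₁₂, hM.isHermitian.apply]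
  · rcases eq_or_ne i j with rfl | hij
    · simp [hdiag]; ring
    · simp [hij]

end Gram

/-! ### The hard half of Haagerup's theorem. -/

section Haagerup

variable {m n : Type*} [Fintype m] [Fintype n] [DecidableEq n]

theorem norm_map_star_le_one {U : Matrix m n ℂ} (hU : U * Uᴴ * U = U) : ‖U.map star‖ ≤ 1 := by
  apply l2_opNorm_le_one_of_partialIsometry
  have h : (U.map star)ᴴ = Uᴴ.map star := rfl
  rw [h]
  have := congrArg (fun V : Matrix m n ℂ => V.map (starRingEnd ℂ)) hU
  simp only [Matrix.map_mul] at this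
  exact this

/-- The trace is the bilinear form of `X ⊙ U.map star`, a contraction, evaluated at `α` and `β`;
Cauchy–Schwarz and `2ab ≤ a² + b²` finish. -/
theorem re_sum_hadamard_le (X : Matrix m n ℂ) (hX : schurNorm X ≤ 1) {U : Matrix m n ℂ}
    (hU : U * Uᴴ * U = U) (α : m → ℝ) (β : n → ℝ) :
    2 * (trace (Uᴴ * of fun i j => (α i : ℂ) * X i j * β j)).re ≤
      ∑ i, α i ^ 2 + ∑ j, β j ^ 2 := by
  have e : trace (Uᴴ * of fun i j => (α i : ℂ) * X i j * β j) =
      (fun i => (α i : ℂ)) ⬝ᵥ (X ⊙ U.map star) *ᵥ fun j => (β j : ℂ) := by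
    simp only [trace, diag, mul_apply, dotProduct, mulVec, conjTranspose_apply, of_apply,
      hadamard_apply, map_apply, Finset.mul_sum]
    rw [Finset.sum_comm]
    refine Finset.sum_congr rfl fun i _ => Finset.sum_congr rfl fun j _ => ?_
    ring
  have h1 := norm_dotProduct_mulVec_le (X ⊙ U.map star) (fun i => (α i : ℂ))
    (fun j => (β j : ℂ))
  rw [← e] at h1
  have h2 : ‖X ⊙ U.map star‖ ≤ 1 :=
    (norm_hadamard_le _ _).trans
      (mul_le_one₀ hX (norm_nonneg _) (norm_map_star_le_one hU))
  simp only [Complex.norm_real, Real.norm_eq_abs, sq_abs] at h1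
  set a := √(∑ i, α i ^ 2) with ha
  set b := √(∑ j, β j ^ 2) with hb
  have ha2 : a ^ 2 = ∑ i, α i ^ 2 := Real.sq_sqrt (Finset.sum_nonneg fun i _ => sq_nonneg _)
  have hb2 : b ^ 2 = ∑ i, β i ^ 2 := Real.sq_sqrt (Finset.sum_nonneg fun i _ => sq_nonneg _)
  have hab : 0 ≤ a * b := mul_nonneg (Real.sqrt_nonneg _) (Real.sqrt_nonneg _)
  have h3 := (Complex.re_le_norm _).trans (h1.trans (mul_le_of_le_one_left hab h2))
  nlinarith [sq_nonneg (a - b)]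

/-- For strictly positive weights, `X` has a positive completion whose weighted diagonal is
controlled. -/
theorem exists_posSemidef_weighted (X : Matrix m n ℂ) (hX : schurNorm X ≤ 1) (α : m → ℝ)
    (β : n → ℝ) (hα : ∀ i, 0 < α i) (hβ : ∀ j, 0 < β j) :
    ∃ M : Matrix (m ⊕ n) (m ⊕ n) ℂ, M.PosSemidef ∧ M.toBlocks₁₂ = X ∧
      ∑ i, α i ^ 2 * (M (.inl i) (.inl i)).re + ∑ j, β j ^ 2 * (M (.inr j) (.inr j)).re ≤
        ∑ i, α i ^ 2 + ∑ j, β j ^ 2 := by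
  classical
  set T : Matrix m n ℂ := of fun i j => (α i : ℂ) * X i j * β j with hT
  obtain ⟨U, H, K, hH, -, hTU, -, hU, hHU, -⟩ := exists_polar T
  have hαc : ∀ i, (α i : ℂ) ≠ 0 := fun i => by exact_mod_cast (hα i).ne'
  have hβc : ∀ i, (β i : ℂ) ≠ 0 := fun i => by exact_mod_cast (hβ i).ne'
  -- With `T = U * H`, the corner of `N * H * Nᴴ` is `T` with the weights divided out, namely `X`,
  -- and each weighted half of the diagonal sums to `trace H`.
  set N : Matrix (m ⊕ n) n ℂ :=
    fromRows (of fun i s => (α i : ℂ)⁻¹ * U i s) (diagonal fun j => (β j : ℂ)⁻¹) with hN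
  refine ⟨N * H * Nᴴ, hH.mul_mul_conjTranspose_same N, ?_, ?_⟩
  · ext i j
    have h1 : (N * H * Nᴴ) (.inl i) (.inr j) = (α i : ℂ)⁻¹ * (U * H) i j * (β j : ℂ)⁻¹ := by
      simp [hN, mul_apply, Finset.mul_sum, Finset.sum_mul, diagonal_apply, mul_assoc, apply_ite (starRingEnd ℂ)]
    rw [toBlocks₁₂, of_apply, h1, ← hTU, hT, of_apply]
    field_simp [hαc i, hβc j]
  · have h1 (i : m) : (α i : ℂ) ^ 2 * (N * H * Nᴴ) (.inl i) (.inl i) = (U * H * Uᴴ) i i := by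
      have : (N * H * Nᴴ) (.inl i) (.inl i) =
          (α i : ℂ)⁻¹ * (U * H * Uᴴ) i i * (α i : ℂ)⁻¹ := by
        simp only [hN, mul_apply, fromRows_apply_inl, of_apply, conjTranspose_apply, star_mul',
          star_inv₀, Complex.star_def, Complex.conj_ofReal, Finset.mul_sum, Finset.sum_mul]
        exact Finset.sum_congr rfl fun _ _ => Finset.sum_congr rfl fun _ _ => by ring
      rw [this]
      field_simp [hαc i]
    have h2 (j : n) : (β j : ℂ) ^ 2 * (N * H * Nᴴ) (.inr j) (.inr j) = H j j := by
      have : (N * H * Nᴴ) (.inr j) (.inr j) = (β j : ℂ)⁻¹ * H j j * (β j : ℂ)⁻¹ := by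
        simp [hN, mul_apply, diagonal_apply, mul_assoc, apply_ite (starRingEnd ℂ)]
      rw [this]
      field_simp [hβc j]
    have h3 : ∑ i, α i ^ 2 * ((N * H * Nᴴ) (.inl i) (.inl i)).re = (trace H).re := by
      have : trace (U * H * Uᴴ) = trace H := by
        rw [Matrix.mul_assoc, trace_mul_comm, Matrix.mul_assoc, trace_mul_comm, ← hHU]
      rw [← this, trace, Complex.re_sum]
      refine Finset.sum_congr rfl fun i _ => ?_
      rw [diag, ← h1, ← Complex.ofReal_pow, Complex.re_ofReal_mul]
    have h4 : ∑ j, β j ^ 2 * ((N * H * Nᴴ) (.inr j) (.inr j)).re = (trace H).re := by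
      rw [trace, Complex.re_sum]
      refine Finset.sum_congr rfl fun i _ => ?_
      rw [diag, ← h2, ← Complex.ofReal_pow, Complex.re_ofReal_mul]
    have h5 := re_sum_hadamard_le X hX hU α β
    rw [← hT, hTU, ← Matrix.mul_assoc, ← hHU] at h5
    rw [h3, h4]
    linarith

theorem exists_isGramDominated_weighted (X : Matrix m n ℂ) (hX : schurNorm X ≤ 1)
    (w : m ⊕ n → ℝ) (hw : ∀ s, 0 < w s) :
    ∃ d : m ⊕ n → ℝ, IsGramDominated X d ∧ (∀ s, 0 ≤ d s) ∧ ∑ s, w s * d s ≤ ∑ s, w s := by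
  obtain ⟨M, hM, hMX, h⟩ := exists_posSemidef_weighted X hX (fun i => √(w (.inl i)))
    (fun j => √(w (.inr j))) (fun i => Real.sqrt_pos.2 (hw _)) (fun i => Real.sqrt_pos.2 (hw _))
  refine ⟨fun s => (M s s).re, ⟨M, hM, hMX, fun s => le_rfl⟩, fun s => ?_, ?_⟩
  · exact (Complex.nonneg_iff.1 hM.diag_nonneg).1
  · simp only [Real.sq_sqrt (hw _).le] at h
    simpa [Fintype.sum_sum_type] using h

/-- Were the constant `1 + ε` infeasible, a linear functional would separate it from the convex set
of feasible diagonals. Upward closedness makes its coefficients nonnegative, so they act as weights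
and contradict the weighted bound. -/
theorem isGramDominated_one_add (X : Matrix m n ℂ) (hX : schurNorm X ≤ 1) {ε : ℝ} (hε : 0 < ε) :
    IsGramDominated X fun _ => 1 + ε := by
  classical
  by_contra hcon
  set S : Set (m ⊕ n → ℝ) := {d | ∃ e, IsGramDominated X e ∧ ∀ s, e s < d s} with hS
  have hSo : IsOpen S := by
    have : S = ⋃ e ∈ {e | IsGramDominated X e}, {d : m ⊕ n → ℝ | ∀ s, e s < d s} := by
      ext d; simp only [hS, Set.mem_ofPred_eq, Set.mem_iUnion, exists_prop]
    rw [this]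
    refine isOpen_biUnion fun e _ => ?_
    simp only [Set.ofPred_forall]
    exact isOpen_iInter_of_finite fun s => isOpen_lt continuous_const (continuous_apply s)
  have hSc : Convex ℝ S := by
    rintro d ⟨e, he, hde⟩ d' ⟨e', he', hde'⟩ a b ha hb hab
    refine ⟨a • e + b • e', ?_, fun s => ?_⟩
    · have := (he.smul ha).add (he'.smul hb)
      rwa [← add_smul, ← Complex.ofReal_add, hab, Complex.ofReal_one, one_smul] at this
    · simp only [Pi.add_apply, Pi.smul_apply, smul_eq_mul]
      rcases ha.eq_or_lt with rfl | ha
      · have : b = 1 := by linarith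
        simpa [this] using hde' s
      · exact add_lt_add_of_lt_of_le (mul_lt_mul_of_pos_left (hde s) ha)
          (mul_le_mul_of_nonneg_left (hde' s).le hb)
  have hpt : (fun _ => 1 + ε) ∉ S := by
    rintro ⟨e, he, hlt⟩
    exact hcon (he.mono fun s => (hlt s).le)
  obtain ⟨f, hf⟩ := geometric_hahn_banach_point_open hSc hSo hpt
  set a : m ⊕ n → ℝ := fun s => f (Pi.single s 1) with ha
  have hfa (d : m ⊕ n → ℝ) : f d = ∑ s, a s * d s := by
    have := (f : (m ⊕ n → ℝ) →ₗ[ℝ] ℝ).pi_apply_eq_sum_univ d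
    simp only [ContinuousLinearMap.coe_coe, smul_eq_mul] at this
    rw [this]
    refine Finset.sum_congr rfl fun s _ => ?_
    rw [mul_comm, ha]
    congr 2
    ext t
    simp [Pi.single_apply, eq_comm]
  obtain ⟨d₀, hd₀, -, -⟩ := exists_isGramDominated_weighted X hX (fun _ => 1) fun _ => one_pos
  have hd₁ : (fun s => d₀ s + 1) ∈ S := ⟨d₀, hd₀, fun s => lt_add_one _⟩
  have ha0 (s : m ⊕ n) : 0 ≤ a s := by
    by_contra! hs
    set c := f (fun _ => 1 + ε) - f (fun s => d₀ s + 1) with hc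
    have hc0 : c < 0 := by have := hf _ hd₁; linarith
    -- This nonnegative shift in coordinate `s` changes `f` by exactly `c`, reaching the value at
    -- the separated point, which strict separation forbids.
    have hmem : (fun s => d₀ s + 1) + (c / a s) • (Pi.single s 1 : m ⊕ n → ℝ) ∈ S := by
      refine ⟨d₀, hd₀, fun t => ?_⟩
      have h1 : 0 ≤ c / a s := div_nonneg_of_nonpos hc0.le hs.le
      have h2 : (0 : ℝ) ≤ (Pi.single s 1 : m ⊕ n → ℝ) t := by
        rw [Pi.single_apply]; split_ifs <;> norm_num
      have := mul_nonneg h1 h2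
      simp only [Pi.add_apply, Pi.smul_apply, smul_eq_mul]
      linarith
    have := hf _ hmem
    rw [map_add, map_smul, smul_eq_mul, show f (Pi.single s 1) = a s from rfl,
      div_mul_cancel₀ _ hs.ne] at this
    linarith
  have hsum : 0 ≤ ∑ s, a s := Finset.sum_nonneg fun s _ => ha0 s
  have hsum0 : 0 < ∑ s, a s := by
    refine hsum.lt_of_ne fun h0 => ?_
    have hz := (Finset.sum_eq_zero_iff_of_nonneg fun s _ => ha0 s).1 h0.symm
    have := hf _ hd₁
    rw [hfa, hfa] at this
    simp only [Finset.mem_univ, true_implies] at hz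
    simp [hz] at this
  set N : ℝ := (Fintype.card (m ⊕ n) : ℝ) with hN
  have hN0 : 0 ≤ N := Nat.cast_nonneg _
  -- The weights must be strictly positive; adding `η` to each costs at most a quarter of `ε * ∑ a`,
  -- below the half left over when `d` is raised by `ε / 2`.
  set η := ε * (∑ s, a s) / (4 * (N + 1)) with hη
  have hη0 : 0 < η := by positivity
  have hηN : η * N ≤ ε * (∑ s, a s) / 4 := by
    rw [hη, div_mul_eq_mul_div, div_le_div_iff₀ (by positivity) (by norm_num)]
    nlinarith [mul_pos hε hsum0]
  obtain ⟨d, hd, hd0, hdw⟩ := exists_isGramDominated_weighted X hX (fun s => a s + η)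
    fun s => add_pos_of_nonneg_of_pos (ha0 s) hη0
  have h1 := hf (fun s => d s + ε / 2) ⟨d, hd, fun s => by linarith⟩
  rw [hfa, hfa] at h1
  have h2 : ∑ s, a s * d s ≤ ∑ s, (a s + η) * d s :=
    Finset.sum_le_sum fun s _ => mul_le_mul_of_nonneg_right (by linarith) (hd0 s)
  have h3 : ∑ s : m ⊕ n, (a s + η) = ∑ s, a s + η * N := by
    rw [Finset.sum_add_distrib, Finset.sum_const, nsmul_eq_mul, Finset.card_univ, mul_comm η]
  simp only [mul_add, Finset.sum_add_distrib, ← Finset.sum_mul, mul_one] at h1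
  nlinarith [mul_pos hε hsum0]

theorem isGramDominated_one (X : Matrix m n ℂ) (hX : schurNorm X ≤ 1) :
    IsGramDominated X fun _ => 1 := by
  set C : ℕ → Set (Matrix (m ⊕ n) (m ⊕ n) ℂ) := fun k =>
    {C | (Cᴴ * C).toBlocks₁₂ = X ∧ ∀ s, ((Cᴴ * C) s s).re ≤ 1 + 1 / ((k : ℝ) + 1)} with hC
  have hcont : Continuous fun C : Matrix (m ⊕ n) (m ⊕ n) ℂ => Cᴴ * C :=
    (continuous_id.matrix_conjTranspose).matrix_mul continuous_id
  have hclosed (k) : IsClosed (C k) := by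
    refine IsClosed.inter ?_ ?_
    · refine isClosed_eq ?_ continuous_const
      exact continuous_matrix fun i j => hcont.matrix_elem _ _
    · change IsClosed {C : Matrix (m ⊕ n) (m ⊕ n) ℂ |
        ∀ s, ((Cᴴ * C) s s).re ≤ 1 + 1 / ((k : ℝ) + 1)}
      simp only [Set.ofPred_forall]
      exact isClosed_iInter fun s => isClosed_le
        (Complex.continuous_re.comp (hcont.matrix_elem s s)) continuous_const
  have hcpt : IsCompact (C 0) := by
    -- For `k = 0` each column of `A` has square norm at most 2, so every entry has norm at most 2.
    have hK : IsCompact (Set.univ.pi fun _ : m ⊕ n => Set.univ.pi fun _ : m ⊕ n =>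
        Metric.closedBall (0 : ℂ) 2) :=
      isCompact_univ_pi fun _ => isCompact_univ_pi fun _ => isCompact_closedBall _ _
    refine hK.of_isClosed_subset (hclosed 0) ?_
    rintro (A : Matrix (m ⊕ n) (m ⊕ n) ℂ) ⟨-, hA⟩ s - t -
    have h := hA t
    have e : ((Aᴴ * A) t t).re = ∑ r, ‖A r t‖ ^ 2 := by
      rw [mul_apply, Complex.re_sum]
      refine Finset.sum_congr rfl fun r _ => ?_
      rw [conjTranspose_apply, Complex.star_def, Complex.conj_mul', ← Complex.ofReal_pow,
        Complex.ofReal_re]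
    have h1 : ‖A s t‖ ^ 2 ≤ ∑ r, ‖A r t‖ ^ 2 :=
      Finset.single_le_sum (f := fun r => ‖A r t‖ ^ 2) (fun r _ => sq_nonneg _)
        (Finset.mem_univ s)
    rw [mem_closedBall_zero_iff]
    norm_num at h
    nlinarith [norm_nonneg (A s t)]
  have hmono (k) : C (k + 1) ⊆ C k := by
    refine fun A hA => ⟨hA.1, fun s => (hA.2 s).trans ?_⟩
    push_cast
    gcongr
    linarith
  have hne (k) : (C k).Nonempty := by
    obtain ⟨M, hM, hMX, hMd⟩ := isGramDominated_one_add X hX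
      (ε := 1 / ((k : ℝ) + 1)) (by positivity)
    obtain ⟨A, rfl⟩ := hM.exists_gram
    exact ⟨A, hMX, hMd⟩
  obtain ⟨A, hA⟩ := IsCompact.nonempty_iInter_of_sequence_nonempty_isCompact_isClosed C
    hmono hne hcpt hclosed
  rw [Set.mem_iInter] at hA
  refine ⟨Aᴴ * A, posSemidef_conjTranspose_mul_self A, (hA 0).1, fun s => ?_⟩
  have ht := (tendsto_one_div_add_atTop_nhds_zero_nat (𝕜 := ℝ)).const_add 1
  rw [add_zero] at ht
  exact ge_of_tendsto' ht fun k => (hA k).2 s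

/-- Haagerup's theorem: a Schur multiplier of norm at most `r` is given by vectors of square
norm at most `r`. -/
theorem isGramDominated_of_schurNorm_le {X : Matrix m n ℂ} {r : ℝ} (hr : 0 < r)
    (hX : schurNorm X ≤ r) : IsGramDominated X fun _ => r := by
  have hrc : (r : ℂ) ≠ 0 := by exact_mod_cast hr.ne'
  have h : schurNorm ((r : ℂ)⁻¹ • X) ≤ 1 := by
    rw [schurNorm_smul, norm_inv, Complex.norm_real, Real.norm_of_nonneg hr.le]
    exact (inv_mul_le_one₀ hr).2 hX
  have := (isGramDominated_one _ h).smul hr.le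
  rw [smul_smul, mul_inv_cancel₀ hrc, one_smul] at this
  exact this.mono fun s => by simp

end Haagerup

/-! ### From a Gram factorization to a Schur factorization. -/

section Reduction

variable {k m n : Type*}

theorem Matrix.PosSemidef.diag_le_one_iff {M : Matrix m m ℂ} (hM : M.PosSemidef) (i : m) :
    M i i ≤ 1 ↔ (M i i).re ≤ 1 := by
  have him : (M i i).im = 0 := (Complex.nonneg_iff.1 hM.diag_nonneg).2.symm
  simp [Complex.le_def, him]

variable [Fintype k] [Fintype m]

theorem gram_eq_gram_proj_add {U : Matrix k m ℂ} (hU : U * Uᴴ * U = U) (A : Matrix k n ℂ) :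
    Aᴴ * A = (U * Uᴴ * A)ᴴ * (U * Uᴴ * A) + (A - U * Uᴴ * A)ᴴ * (A - U * Uᴴ * A) := by
  have hP : (U * Uᴴ)ᴴ = U * Uᴴ := by rw [conjTranspose_mul, conjTranspose_conjTranspose]
  have hPP : U * Uᴴ * (U * Uᴴ) = U * Uᴴ := by rw [← Matrix.mul_assoc, hU]
  generalize U * Uᴴ = P at *
  have h1 : Aᴴ * P * (P * A) = Aᴴ * P * A := by
    rw [Matrix.mul_assoc, ← Matrix.mul_assoc P, hPP, ← Matrix.mul_assoc]
  have h2 : (P * A)ᴴ = Aᴴ * P := by rw [conjTranspose_mul, hP]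
  rw [conjTranspose_sub, h2, Matrix.sub_mul, Matrix.mul_sub, Matrix.mul_sub, h1,
    ← Matrix.mul_assoc]
  abel

variable [Fintype n]

theorem gram_proj_diag_le {U : Matrix k m ℂ} (hU : U * Uᴴ * U = U) (A : Matrix k n ℂ) (i : n) :
    ((U * Uᴴ * A)ᴴ * (U * Uᴴ * A)) i i ≤ (Aᴴ * A) i i := by
  rw [gram_eq_gram_proj_add hU A, Matrix.add_apply]
  exact le_add_of_nonneg_right (posSemidef_conjTranspose_mul_self _).diag_nonneg

/-- Every factorization `Aᴴ * B` can be brought into the form `F * W * G` without increasing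
the diagonals of the Gram matrices. -/
theorem exists_reduced_factorization (A : Matrix k m ℂ) (B : Matrix k n ℂ) :
    ∃ (F : Matrix m m ℂ) (W : Matrix m n ℂ) (G : Matrix n n ℂ), Aᴴ * B = F * W * G ∧
      F.PosSemidef ∧ G.PosSemidef ∧ IsPartialIsometryBetween F W G ∧
      (∀ i, (F * F) i i ≤ (Aᴴ * A) i i) ∧ ∀ j, (G * G) j j ≤ (Bᴴ * B) j j := by
  -- `A₁` is `A` projected onto the range of `B`, and `B₁` is `B` projected onto the range of `A₁`.
  -- The product is unchanged and the two ranges become equal, so from `A₁ = U * F` and `B₁ = V * G`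
  -- one may take `W = Uᴴ * V`.
  obtain ⟨S, HS, KS, -, -, hBS, hSB, hS, -, -⟩ := exists_polar B
  set A₁ := S * Sᴴ * A with hA₁
  obtain ⟨U, F, KU, hF, hFF, hAU, hUA, hU, hFU, hUF⟩ := exists_polar A₁
  set B₁ := U * Uᴴ * B with hB₁
  obtain ⟨V, G, KV, hG, hGG, hBV, hVB, hV, hGV, hVG⟩ := exists_polar B₁
  have hSSB : S * Sᴴ * B = B := by rw [hBS, ← Matrix.mul_assoc, hS]
  have hUA₁ : U * Uᴴ * A₁ = A₁ := by
    conv_lhs => rw [hAU]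
    rw [← Matrix.mul_assoc, hU, ← hAU]
  have hAB : A₁ᴴ * B₁ = Aᴴ * B := by
    have h1 : A₁ᴴ * (U * Uᴴ) = A₁ᴴ := by
      have := congrArg conjTranspose hUA₁
      simpa [conjTranspose_mul, Matrix.mul_assoc] using this
    rw [hB₁, ← Matrix.mul_assoc, h1, hA₁, conjTranspose_mul, conjTranspose_mul,
      conjTranspose_conjTranspose, Matrix.mul_assoc, hSSB]
  have hVU : V * Vᴴ * U = U := by
    have h1 : V * Vᴴ * B₁ = B₁ := by
      conv_lhs => rw [hBV]
      rw [← Matrix.mul_assoc, hV, ← hBV]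
    have h2 : A₁ = B₁ * (KS * Sᴴ * A) := by
      have h3 : A₁ = B * (KS * Sᴴ * A) := by
        rw [← Matrix.mul_assoc, ← Matrix.mul_assoc, ← hSB, hA₁]
      rw [← hUA₁, hB₁, Matrix.mul_assoc _ B, ← h3]
    rw [hUA, h2, ← Matrix.mul_assoc, ← Matrix.mul_assoc, h1]
  have hUV : U * Uᴴ * V = V := by
    rw [hVB, hB₁, ← Matrix.mul_assoc, ← Matrix.mul_assoc, ← Matrix.mul_assoc, hU]
  have hUVc : Vᴴ * U * Uᴴ = Vᴴ := by
    have := congrArg conjTranspose hUV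
    simpa [conjTranspose_mul, Matrix.mul_assoc] using this
  have hVUc : Uᴴ * V * Vᴴ = Uᴴ := by
    have := congrArg conjTranspose hVU
    simpa [conjTranspose_mul, Matrix.mul_assoc] using this
  have hWc : (Uᴴ * V)ᴴ = Vᴴ * U := by rw [conjTranspose_mul, conjTranspose_conjTranspose]
  refine ⟨F, Uᴴ * V, G, ?_, hF, hG, ⟨?_, ?_, ?_⟩, fun i => ?_, fun j => ?_⟩
  · rw [← hAB]
    conv_lhs => rw [hAU, hBV]
    rw [conjTranspose_mul, hF.isHermitian.eq]
    simp only [Matrix.mul_assoc]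
  · rw [hWc]
    calc Uᴴ * V * (Vᴴ * U) * (Uᴴ * V) = Uᴴ * (V * Vᴴ * U) * (Uᴴ * V) := by
          simp only [Matrix.mul_assoc]
      _ = Uᴴ * (U * Uᴴ * V) := by rw [hVU]; simp only [Matrix.mul_assoc]
      _ = Uᴴ * V := by rw [hUV]
  · rw [hWc]
    refine range_mulVecLin_eq (C := KV * Vᴴ * U) (D := Uᴴ * V * G) ?_ ?_
    · conv_lhs => rw [hVG]
      simp only [Matrix.mul_assoc]
    · rw [← Matrix.mul_assoc, ← Matrix.mul_assoc, hUVc, ← hGV]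
  · refine range_mulVecLin_eq (C := KU * Uᴴ * V) (D := Vᴴ * U * F) ?_ ?_
    · conv_lhs => rw [hUF]
      simp only [Matrix.mul_assoc]
    · rw [← Matrix.mul_assoc, ← Matrix.mul_assoc, hVUc, ← hFU]
  · rw [hFF]
    exact gram_proj_diag_le hS A i
  · rw [hGG]
    exact gram_proj_diag_le hU B j

end Reduction

section Existence

variable {m n : Type*} [Fintype m] [Fintype n] [DecidableEq m] [DecidableEq n]

theorem exists_isSchurFactorization (X : Matrix m n ℂ) :
    ∃ F W G, IsSchurFactorization X F W G := by
  rcases (schurNorm_nonneg X).eq_or_lt with h0 | hpos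
  · refine ⟨0, 0, 0, ?_, PosSemidef.zero, ?_, PosSemidef.zero, ?_, ?_, ?_, ?_⟩
    · rw [eq_zero_of_schurNorm_eq_zero h0.symm]; simp
    · simp
    · simp
    · simp
    · simp
    · simp
  · set c := schurNorm X with hc
    have hcc : (c : ℂ) ≠ 0 := by exact_mod_cast hpos.ne'
    have h1 : schurNorm ((c : ℂ)⁻¹ • X) ≤ 1 := by
      rw [schurNorm_smul, norm_inv, Complex.norm_real, Real.norm_of_nonneg hpos.le, ← hc,
        inv_mul_cancel₀ hpos.ne']
    obtain ⟨A, B, hAB, hA, hB⟩ := (isGramDominated_one _ h1).exists_factorization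
    obtain ⟨F, W, G, hFWG, hF, hG, hW, hFA, hGB⟩ := exists_reduced_factorization A B
    refine ⟨F, W, G, ?_, hF, fun i => ?_, hG, fun j => ?_, hW⟩
    · rw [← hFWG, hAB, smul_smul, ← hc, mul_inv_cancel₀ hcc, one_smul]
    · rw [sq]
      exact (hFA i).trans (((posSemidef_conjTranspose_mul_self A).diag_le_one_iff i).2 (hA i))
    · rw [sq]
      exact (hGB j).trans (((posSemidef_conjTranspose_mul_self B).diag_le_one_iff j).2 (hB j))

end Existence

/-! ### Extremality of the right diagonal when column deletion lowers the norm. -/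

section Uniqueness

variable {m n : Type*} [Fintype m] [Fintype n] [DecidableEq n]

theorem IsGramDominated.of_deleteCol {X : Matrix m n ℂ} {j : n} {r : ℝ}
    (h : IsGramDominated (deleteCol X j) fun _ => r) :
    IsGramDominated (of fun i k => if k = j then 0 else X i k)
      (Sum.elim (fun _ => r) fun k => if k = j then 0 else r) := by
  obtain ⟨A, B, hAB, hA, hB⟩ := h.exists_factorization
  set B' : Matrix (m ⊕ {k // k ≠ j}) n ℂ :=
    of fun s k => if hk : k = j then 0 else B s ⟨k, hk⟩ with hB'
  have e : Aᴴ * B' = of fun i k => if k = j then 0 else X i k := by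
    ext i k
    by_cases hk : k = j
    · simp [mul_apply, hB', hk]
    · have := congrFun (congrFun hAB i) ⟨k, hk⟩
      simp only [mul_apply, deleteCol, submatrix_apply, id] at this
      simp [mul_apply, hB', hk, ← this]
  rw [← e]
  refine (isGramDominated_conjTranspose_mul A B').mono ?_
  rintro (i | k)
  · exact hA i
  · by_cases hk : k = j
    · simp [mul_apply, hB', hk]
    · have := hB ⟨k, hk⟩
      simpa [mul_apply, hB', hk] using this

/-- Rescaling the two factors inversely makes the row cost as small as desired, at the price of a
large cost at `j` alone. -/
theorem isGramDominated_single_col (x : m → ℂ) (j : n) {ε : ℝ} (hε : 0 < ε) :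
    ∃ K : ℝ, 0 ≤ K ∧ IsGramDominated (of fun i k => if k = j then x i else 0)
      (Sum.elim (fun _ => ε) fun k => if k = j then K else 0) := by
  classical
  set B : Matrix m n ℂ := of fun i k => if k = j then ((√ε : ℝ) : ℂ)⁻¹ * x i else 0 with hB
  have hs : ((√ε : ℝ) : ℂ) ≠ 0 := by exact_mod_cast (Real.sqrt_pos.2 hε).ne'
  have e : (((√ε : ℝ) : ℂ) • (1 : Matrix m m ℂ))ᴴ * B =
      of fun i k => if k = j then x i else 0 := by
    ext i k
    by_cases hk : k = j <;> simp [hB, hk, hs]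
  refine ⟨((Bᴴ * B) j j).re,
    (Complex.nonneg_iff.1 (posSemidef_conjTranspose_mul_self B).diag_nonneg).1, ?_⟩
  rw [← e]
  refine (isGramDominated_conjTranspose_mul _ B).mono ?_
  rintro (i | k)
  · simp [← Complex.ofReal_mul, Real.mul_self_sqrt hε.le]
  · by_cases hk : k = j
    · simp [hk]
    · simp [mul_apply, hB, hk]

/-- If deleting the column `j` decreases the Schur norm, the `j`-th diagonal entry in a feasible
pair of Gram matrices is extremal. -/
theorem one_le_of_isGramDominated {X : Matrix m n ℂ} (hX : schurNorm X = 1) {j : n}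
    (hj : schurNorm (deleteCol X j) < 1) {d : m ⊕ n → ℝ} (hd : IsGramDominated X d)
    (h1 : ∀ s, d s ≤ 1) : 1 ≤ d (.inr j) := by
  by_contra! hlt
  obtain ⟨c, hc, hc1⟩ := exists_between hj
  have hc0 : 0 < c := (schurNorm_nonneg _).trans_lt hc
  have hdom := (isGramDominated_of_schurNorm_le hc0 hc.le).of_deleteCol
  obtain ⟨K, hK, hcol⟩ := isGramDominated_single_col (fun i => X i j) j
    (ε := (1 - c) / 2) (by linarith)
  have hadd := hdom.add hcol
  have hXX : (of fun i k => if k = j then 0 else X i k) +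
      (of fun i k => if k = j then X i j else 0) = X := by
    ext i k
    by_cases hk : k = j <;> simp [hk]
  rw [hXX] at hadd
  set q := max (d (.inr j)) 0 with hq
  have hq1 : q < 1 := max_lt hlt one_pos
  -- Mixing with weight `t` gains at least `t * (1 - c) / 2` away from `j`, while the entry at `j`
  -- is at most `q + t * (1 + K) = (1 + q) / 2`.
  set t := (1 - q) / (2 * (1 + K)) with ht
  have ht0 : 0 < t := div_pos (by linarith) (by linarith)
  have htK : t * (1 + K) = (1 - q) / 2 := by rw [ht]; field_simp
  have hq0 : 0 ≤ q := le_max_right _ _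
  have ht1 : t < 1 := by nlinarith
  have hmix := (hd.smul (t := 1 - t) (by linarith)).add (hadd.smul ht0.le)
  rw [← add_smul, ← Complex.ofReal_add, sub_add_cancel, Complex.ofReal_one, one_smul] at hmix
  set r := max (1 - t * ((1 - c) / 2)) ((1 + q) / 2) with hr
  have hr1 : r < 1 := max_lt (by nlinarith) (by linarith)
  have hr0 : 0 < r := lt_max_of_lt_right (by linarith)
  have := (hmix.mono (e := fun _ => r) ?_).schurNorm_le hr0
  · linarith
  rintro (i | k)
  · refine le_trans ?_ (le_max_left _ _)
    have := h1 (.inl i)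
    simp only [Pi.add_apply, Pi.smul_apply, Sum.elim_inl, smul_eq_mul]
    nlinarith
  · by_cases hk : k = j
    · refine le_trans ?_ (le_max_right _ _)
      subst hk
      have : d (.inr k) ≤ q := le_max_left _ _
      simp only [Pi.add_apply, Pi.smul_apply, Sum.elim_inr, smul_eq_mul, if_true]
      nlinarith
    · refine le_trans ?_ (le_max_left _ _)
      have := h1 (.inr k)
      simp only [Pi.add_apply, Pi.smul_apply, Sum.elim_inr, smul_eq_mul, if_neg hk]
      nlinarith

/-- Projecting `B` onto the range of `A` preserves `Aᴴ * B`, so extremality keeps its Gram diagonal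
at 1; by Pythagoras the discarded part vanishes. -/
theorem exists_eq_mul_of_deleteCol_lt {k : Type*} [Fintype k] {X : Matrix m n ℂ}
    (hX : schurNorm X = 1) (hdel : ∀ j, schurNorm (deleteCol X j) < 1) {A : Matrix k m ℂ}
    {B : Matrix k n ℂ} (hAB : Aᴴ * B = X) (hA : ∀ i, ((Aᴴ * A) i i).re ≤ 1)
    (hB : ∀ j, ((Bᴴ * B) j j).re ≤ 1) : ∃ Z : Matrix m n ℂ, B = A * Z := by
  obtain ⟨U, H, K, -, -, hAU, hUA, hU, -, -⟩ := exists_polar A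
  have hUUA : U * Uᴴ * A = A := by
    conv_lhs => rw [hAU]
    rw [← Matrix.mul_assoc, hU, ← hAU]
  have hAUU : Aᴴ * (U * Uᴴ) = Aᴴ := by
    have := congrArg conjTranspose hUUA
    simpa [conjTranspose_mul, Matrix.mul_assoc] using this
  have hAB' : Aᴴ * (U * Uᴴ * B) = X := by rw [← Matrix.mul_assoc, hAUU, hAB]
  have hdom := isGramDominated_conjTranspose_mul A (U * Uᴴ * B)
  rw [hAB'] at hdom
  have hB' (j) : (((U * Uᴴ * B)ᴴ * (U * Uᴴ * B)) j j).re ≤ 1 :=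
    (Complex.le_def.1 (gram_proj_diag_le hU B j)).1.trans (hB j)
  have hge (j) : 1 ≤ (((U * Uᴴ * B)ᴴ * (U * Uᴴ * B)) j j).re :=
    one_le_of_isGramDominated hX (hdel j) hdom (by
      rintro (i | k)
      · exact hA i
      · exact hB' k)
  have hzero : (B - U * Uᴴ * B)ᴴ * (B - U * Uᴴ * B) = 0 := by
    have hps := posSemidef_conjTranspose_mul_self (B - U * Uᴴ * B)
    rw [← hps.trace_eq_zero_iff, trace]
    refine Finset.sum_eq_zero fun j _ => ?_
    have h1 := congrArg Complex.re (congrFun (congrFun (gram_eq_gram_proj_add hU B) j) j)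
    rw [Matrix.add_apply, Complex.add_re] at h1
    have h2 := Complex.nonneg_iff.1 (hps.diag_nonneg (i := j))
    refine Complex.ext ?_ h2.2.symm
    have := hB j
    have := hge j
    simp only [diag_apply, Complex.zero_re]
    linarith [h2.1]
  rw [conjTranspose_mul_self_eq_zero, sub_eq_zero] at hzero
  refine ⟨K * Uᴴ * B, ?_⟩
  rw [← Matrix.mul_assoc, ← Matrix.mul_assoc, ← hUA]
  exact hzero

end Uniqueness

/-! ### Two factors of `F * W * G` recovered from the product and `G`. -/

section PartialIsometry

variable {m n : Type*} [Fintype m] [Fintype n] {F : Matrix m m ℂ} {W : Matrix m n ℂ}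
  {G : Matrix n n ℂ}

theorem IsPartialIsometryBetween.conjTranspose (h : IsPartialIsometryBetween F W G) :
    IsPartialIsometryBetween G Wᴴ F where
  partialIsometry := by
    simpa [conjTranspose_mul, Matrix.mul_assoc] using congrArg Matrix.conjTranspose
      h.partialIsometry
  initial := by rw [conjTranspose_conjTranspose]; exact h.final
  final := h.initial

theorem IsPartialIsometryBetween.exists_eq_left_mul (h : IsPartialIsometryBetween F W G) :
    ∃ C : Matrix m n ℂ, W = F * C :=
  exists_eq_mul_of_range_le h.final.le

theorem IsPartialIsometryBetween.mul_conjTranspose_mul_left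
    (h : IsPartialIsometryBetween F W G) : W * Wᴴ * F = F := by
  obtain ⟨C, hC⟩ := exists_eq_mul_of_range_le h.final.ge
  rw [hC, ← Matrix.mul_assoc, h.partialIsometry]

theorem IsPartialIsometryBetween.conjTranspose_mul_mul_right
    (h : IsPartialIsometryBetween F W G) : Wᴴ * W * G = G := by
  simpa using h.conjTranspose.mul_conjTranspose_mul_left

/-- The middle factor is determined by the outer ones. -/
theorem IsPartialIsometryBetween.eq_of_mul_eq {W' : Matrix m n ℂ} (hF : F.IsHermitian)
    (h : IsPartialIsometryBetween F W G)
    (h' : IsPartialIsometryBetween F W' G) (he : F * W * G = F * W' * G) : W = W' := by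
  obtain ⟨C, hC⟩ := h.exists_eq_left_mul
  obtain ⟨C', hC'⟩ := h'.exists_eq_left_mul
  obtain ⟨D, hD⟩ := h.conjTranspose.exists_eq_left_mul
  obtain ⟨D', hD'⟩ := h'.conjTranspose.exists_eq_left_mul
  have h1 : F * (W - W') * G = 0 := by rw [Matrix.mul_sub, Matrix.sub_mul, he, sub_self]
  have h2 : (W - W')ᴴ = (C - C')ᴴ * F := by
    rw [hC, hC', ← Matrix.mul_sub, conjTranspose_mul, hF.eq]
  have h3 : (W - W')ᴴ = G * (D - D') := by rw [conjTranspose_sub, hD, hD', ← Matrix.mul_sub]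
  -- The outer copies of `(W - W')ᴴ` supply `F` on one side and `G` on the other, exposing `F * (W -
  -- W') * G = 0`.
  have h4 : (W - W')ᴴ * (W - W') * (W - W')ᴴ = 0 := by
    calc (W - W')ᴴ * (W - W') * (W - W')ᴴ
        = (C - C')ᴴ * F * (W - W') * (G * (D - D')) := by rw [← h2, ← h3]
      _ = (C - C')ᴴ * (F * (W - W') * G) * (D - D') := by simp only [Matrix.mul_assoc]
      _ = 0 := by rw [h1]; simp
  have h5 : (W - W') * (W - W')ᴴ = 0 := by
    rwa [conjTranspose_mul_self_mul_eq_zero] at h4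
  rw [self_mul_conjTranspose_eq_zero, sub_eq_zero] at h5
  exact h5

/-- The left factor is determined by the product and the right factor. -/
theorem IsPartialIsometryBetween.left_eq_of_mul_eq {F' : Matrix m m ℂ} {W' : Matrix m n ℂ}
    (hF : F.PosSemidef) (hF' : F'.PosSemidef) (hG : G.IsHermitian)
    (h : IsPartialIsometryBetween F W G) (h' : IsPartialIsometryBetween F' W' G)
    (he : F * W * G = F' * W' * G) : F = F' := by
  -- Writing `P` for the product, `F² = P * Y` with `Pᴴ = G² * Y`. Two such solutions give `Y'ᴴ * Pᴴ
  -- = Y'ᴴ * G² * Y = P * Y`, hence equal squares.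
  have key : ∀ {F : Matrix m m ℂ} {W : Matrix m n ℂ}, F.IsHermitian →
      IsPartialIsometryBetween F W G →
      ∃ Y : Matrix n m ℂ, F * F = F * W * G * Y ∧ (F * W * G)ᴴ = G * G * Y := by
    intro F W hF h
    obtain ⟨D, hD⟩ := h.conjTranspose.exists_eq_left_mul
    refine ⟨D * F, ?_, ?_⟩
    · rw [Matrix.mul_assoc (F * W), ← Matrix.mul_assoc G, ← hD, Matrix.mul_assoc F W,
        ← Matrix.mul_assoc W, h.mul_conjTranspose_mul_left]
    · rw [Matrix.mul_assoc G, ← Matrix.mul_assoc G D, ← hD, conjTranspose_mul, conjTranspose_mul,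
        hF.eq, hG.eq]
  obtain ⟨Y, hY, hYX⟩ := key hF.isHermitian h
  obtain ⟨Y', hY', hYX'⟩ := key hF'.isHermitian h'
  refine hF.eq_of_mul_self_eq hF' ?_
  have hsq : (F' * F')ᴴ = F' * F' := by rw [conjTranspose_mul, hF'.isHermitian.eq]
  rw [← hsq, hY, hY', ← he, conjTranspose_mul, hYX]
  have h3 : F * W * G = Y'ᴴ * (G * G) := by
    have := congrArg Matrix.conjTranspose hYX'
    rwa [conjTranspose_conjTranspose, conjTranspose_mul, conjTranspose_mul, hG.eq, ← he] at this
  rw [h3, Matrix.mul_assoc]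

end PartialIsometry

theorem smul_fromRows_conjTranspose_mul {l p q : Type*} [Fintype l] (s : ℂ) (A₁ A₂ : Matrix l p ℂ)
    (B₁ B₂ : Matrix l q ℂ) : (s • fromRows A₁ A₂)ᴴ * (s • fromRows B₁ B₂) =
      (star s * s) • (A₁ᴴ * B₁ + A₂ᴴ * B₂) := by
  rw [conjTranspose_smul, Matrix.smul_mul, Matrix.mul_smul, smul_smul,
    conjTranspose_fromRows_eq_fromCols_conjTranspose, fromCols_mul_fromRows]

/-! ### Uniqueness of Schur factorizations. -/

section SchurFactorization

variable {m n : Type*} [Fintype m] [Fintype n] [DecidableEq m] [DecidableEq n]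

theorem IsSchurFactorization.conjTranspose {X : Matrix m n ℂ} {F : Matrix m m ℂ}
    {W : Matrix m n ℂ} {G : Matrix n n ℂ} (h : IsSchurFactorization X F W G) :
    IsSchurFactorization Xᴴ G Wᴴ F where
  eq_smul := by
    conv_lhs => rw [h.eq_smul]
    rw [schurNorm_conjTranspose, conjTranspose_smul, conjTranspose_mul, conjTranspose_mul,
      h.left_pos.isHermitian.eq, h.right_pos.isHermitian.eq, Matrix.mul_assoc]
    simp
  left_pos := h.right_pos
  left_diag := h.right_diag
  right_pos := h.left_pos
  right_diag := h.left_diag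
  isometry := h.isometry.conjTranspose

theorem right_eq_of_deleteCol_lt {X : Matrix m n ℂ} (hX : schurNorm X = 1)
    (hdel : ∀ j, schurNorm (deleteCol X j) < 1) {F₁ F₂ : Matrix m m ℂ} {W₁ W₂ : Matrix m n ℂ}
    {G₁ G₂ : Matrix n n ℂ} (h₁ : IsSchurFactorization X F₁ W₁ G₁)
    (h₂ : IsSchurFactorization X F₂ W₂ G₂) : G₁ = G₂ := by
  have aux : ∀ {F : Matrix m m ℂ} {W : Matrix m n ℂ} {G : Matrix n n ℂ},
      IsSchurFactorization X F W G → Fᴴ * (W * G) = X ∧ (W * G)ᴴ * (W * G) = G * G ∧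
        (∀ i, ((Fᴴ * F) i i).re ≤ 1) ∧ ∀ j, (((W * G)ᴴ * (W * G)) j j).re ≤ 1 := by
    intro F W G h
    have hG : (W * G)ᴴ * (W * G) = G * G := by
      rw [conjTranspose_mul, Matrix.mul_assoc, ← Matrix.mul_assoc Wᴴ,
        h.isometry.conjTranspose_mul_mul_right, h.right_pos.isHermitian.eq]
    refine ⟨?_, hG, fun i => ?_, fun j => ?_⟩
    · rw [h.left_pos.isHermitian.eq, ← Matrix.mul_assoc]
      conv_rhs => rw [h.eq_smul, hX]
      simp
    · rw [h.left_pos.isHermitian.eq, ← sq]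
      exact (Complex.le_def.1 (h.left_diag i)).1
    · rw [hG, ← sq]
      exact (Complex.le_def.1 (h.right_diag j)).1
  obtain ⟨hX₁, hG₁, hA₁, hB₁⟩ := aux h₁
  obtain ⟨hX₂, hG₂, hA₂, hB₂⟩ := aux h₂
  -- Stacking scaled by `√(1/2)` averages the Gram matrices, so the combined pair is again feasible
  -- for `X`.
  set s : ℂ := ((√(1 / 2) : ℝ) : ℂ) with hs
  have hss : star s * s = 1 / 2 := by
    rw [hs, Complex.star_def, Complex.conj_ofReal, ← Complex.ofReal_mul,
      Real.mul_self_sqrt (by norm_num)]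
    norm_num
  have hs0 : s ≠ 0 := by
    rintro h0
    rw [h0, mul_zero] at hss
    norm_num at hss
  obtain ⟨Z, hZ⟩ := exists_eq_mul_of_deleteCol_lt hX hdel
    (A := s • fromRows F₁ F₂) (B := s • fromRows (W₁ * G₁) (W₂ * G₂))
    (by rw [smul_fromRows_conjTranspose_mul, hss, hX₁, hX₂, ← two_smul ℂ, smul_smul]; norm_num)
    (fun i => by
      have := hA₁ i
      have := hA₂ i
      rw [smul_fromRows_conjTranspose_mul, hss, Matrix.smul_apply, Matrix.add_apply, smul_eq_mul,
        ← Complex.ofReal_one, ← Complex.ofReal_ofNat, ← Complex.ofReal_div, Complex.re_ofReal_mul,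
        Complex.add_re]
      linarith)
    (fun j => by
      have := hB₁ j
      have := hB₂ j
      rw [smul_fromRows_conjTranspose_mul, hss, Matrix.smul_apply, Matrix.add_apply, smul_eq_mul,
        ← Complex.ofReal_one, ← Complex.ofReal_ofNat, ← Complex.ofReal_div, Complex.re_ofReal_mul,
        Complex.add_re]
      linarith)
  rw [Matrix.smul_mul, fromRows_mul] at hZ
  have hZ' := smul_right_injective _ hs0 hZ
  rw [fromRows_inj.eq_iff] at hZ'
  obtain ⟨hZ₁, hZ₂⟩ := hZ'
  have fin : ∀ {F : Matrix m m ℂ} {W : Matrix m n ℂ} {G : Matrix n n ℂ},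
      Fᴴ * (W * G) = X → (W * G)ᴴ * (W * G) = G * G → W * G = F * Z → G * G = Zᴴ * X := by
    intro F W G h1 h2 h3
    rw [← h2]
    conv_lhs => arg 1; rw [h3]
    rw [conjTranspose_mul, Matrix.mul_assoc, h1]
  refine h₁.right_pos.eq_of_mul_self_eq h₂.right_pos ?_
  rw [fin hX₁ hG₁ hZ₁, fin hX₂ hG₂ hZ₂]

theorem IsSchurFactorization.normalize {X : Matrix m n ℂ} {F : Matrix m m ℂ}
    {W : Matrix m n ℂ} {G : Matrix n n ℂ} (h : IsSchurFactorization X F W G)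
    (hX : 0 < schurNorm X) :
    IsSchurFactorization ((schurNorm X : ℂ)⁻¹ • X) F W G where
  eq_smul := by
    have hc : (schurNorm X : ℂ) ≠ 0 := by exact_mod_cast hX.ne'
    have h1 : schurNorm ((schurNorm X : ℂ)⁻¹ • X) = 1 := by
      rw [schurNorm_smul, norm_inv, Complex.norm_real, Real.norm_of_nonneg hX.le,
        inv_mul_cancel₀ hX.ne']
    rw [h1, Complex.ofReal_one, one_smul]
    conv_lhs => arg 2; rw [h.eq_smul]
    rw [smul_smul, inv_mul_cancel₀ hc, one_smul]
  left_pos := h.left_pos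
  left_diag := h.left_diag
  right_pos := h.right_pos
  right_diag := h.right_diag
  isometry := h.isometry

theorem existsUnique_of_deleteCol_lt {X : Matrix m n ℂ}
    (hdel : ∀ j, schurNorm (deleteCol X j) < schurNorm X) :
    ∃! p : Matrix m m ℂ × Matrix m n ℂ × Matrix n n ℂ,
      IsSchurFactorization X p.1 p.2.1 p.2.2 := by
  obtain ⟨F, W, G, h⟩ := exists_isSchurFactorization X
  refine ⟨(F, W, G), h, ?_⟩
  rintro ⟨F', W', G'⟩ h'
  simp only at h'
  -- Without columns the hypothesis is vacuous and gives no positivity of the norm, but `W` is empty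
  -- and forces `F = 0`.
  rcases isEmpty_or_nonempty n with hn | ⟨⟨j⟩⟩
  · have key : ∀ {F : Matrix m m ℂ} {W : Matrix m n ℂ} {G : Matrix n n ℂ},
        IsSchurFactorization X F W G → F = 0 := by
      intro F W G h
      rw [← h.isometry.mul_conjTranspose_mul_left, Subsingleton.elim W 0]
      simp
    rw [key h, key h', Subsingleton.elim W W', Subsingleton.elim G G']
  · have hpos : 0 < schurNorm X := (schurNorm_nonneg _).trans_lt (hdel j)
    have hc : ‖(schurNorm X : ℂ)⁻¹‖ = (schurNorm X)⁻¹ := by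
      rw [norm_inv, Complex.norm_real, Real.norm_of_nonneg hpos.le]
    have h1 : schurNorm ((schurNorm X : ℂ)⁻¹ • X) = 1 := by
      rw [schurNorm_smul, hc, inv_mul_cancel₀ hpos.ne']
    have h2 (j) : schurNorm (deleteCol ((schurNorm X : ℂ)⁻¹ • X) j) < 1 := by
      have : deleteCol ((schurNorm X : ℂ)⁻¹ • X) j = (schurNorm X : ℂ)⁻¹ • deleteCol X j := rfl
      rw [this, schurNorm_smul, hc, inv_mul_lt_one₀ hpos]
      exact hdel j
    have hn := h.normalize hpos
    have hn' := h'.normalize hpos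
    obtain rfl := right_eq_of_deleteCol_lt h1 h2 hn hn'
    have he : F * W * G = F' * W' * G := by
      have e := hn.eq_smul.symm.trans hn'.eq_smul
      rw [h1] at e
      simpa using e
    obtain rfl := h.isometry.left_eq_of_mul_eq h.left_pos h'.left_pos h.right_pos.isHermitian
      h'.isometry he
    rw [h.isometry.eq_of_mul_eq h.left_pos.isHermitian h'.isometry he]

theorem existsUnique_of_deleteRow_lt {X : Matrix m n ℂ}
    (hdel : ∀ i, schurNorm (deleteRow X i) < schurNorm X) :
    ∃! p : Matrix m m ℂ × Matrix m n ℂ × Matrix n n ℂ,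
      IsSchurFactorization X p.1 p.2.1 p.2.2 := by
  obtain ⟨⟨G, V, F⟩, h, huniq⟩ := existsUnique_of_deleteCol_lt (X := Xᴴ) fun i => by
    rw [schurNorm_conjTranspose]
    have : deleteCol Xᴴ i = (deleteRow X i)ᴴ := rfl
    rw [this, schurNorm_conjTranspose]
    exact hdel i
  refine ⟨(F, Vᴴ, G), by simpa using h.conjTranspose, ?_⟩
  rintro ⟨F', W', G'⟩ h'
  have := huniq (G', W'ᴴ, F') h'.conjTranspose
  simp only [Prod.mk.injEq] at this ⊢
  exact ⟨this.2.2, by rw [← this.2.1, conjTranspose_conjTranspose], this.1⟩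

end SchurFactorization

theorem proposition2p8 (m n : ℕ) (X : Matrix (Fin m) (Fin n) ℂ) :
    ((∀ j : Fin n, schurNorm (deleteCol X j) < schurNorm X) →
      ∃! p : Matrix (Fin m) (Fin m) ℂ × Matrix (Fin m) (Fin n) ℂ × Matrix (Fin n) (Fin n) ℂ,
        IsSchurFactorization X p.1 p.2.1 p.2.2) ∧
    ((∀ i : Fin m, schurNorm (deleteRow X i) < schurNorm X) →
      ∃! p : Matrix (Fin m) (Fin m) ℂ × Matrix (Fin m) (Fin n) ℂ × Matrix (Fin n) (Fin n) ℂ,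
        IsSchurFactorization X p.1 p.2.1 p.2.2) :=
  ⟨existsUnique_of_deleteCol_lt, existsUnique_of_deleteRow_lt⟩
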